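/- Let $d\ge 1$, $\gamma>0$, $\sigma>0$. Write ${}_1F_1(a;b;z)=\sum_{k\ge 0}\frac{(a)_k}{(b)_k}\frac{z^k}{k!}$ for Kummer's confluent hypergeometric function and put $$K(x,y)={}_1F_1\!\left(\tfrac12;\tfrac d2;-\gamma\|x-y\|_2^2\right),\qquad x,y\in\mathbb R^d .$$ For a probability measure $Q$ on $\mathbb R$ with characteristic function $\phi_Q$ let $$\mathrm{EP}(Q)=\int_{\mathbb R}\left|\phi_Q(\omega)-\phi_{\mathcal N(0,\sigma^2)}(\omega)\right|^2\frac{1}{\sqrt{4\pi\gamma}}\,e^{-\omega^2/(4\gamma)}\,d\omega ,$$ and for a probability measure $P$ on $\mathbb R^d$ let $$\mathrm{SIGReg}(P)=\mathbb E_{\theta\sim\mathcal U(\mathbb S^{d-1})}\left[\mathrm{EP}(\theta^\top_\# P)\right],$$ where $\theta^\top_\#P$ is the law of $\theta^\top x$, $x\sim P$. Let $P$ be any probability measure on $\mathbb R^d$, $n\ge 2$, and $x_1,\dots,x_n$ i.i.d. with law $P$; let $\widehat P_n=\frac1n\sum_{i=1}^n\delta_{x_i}$. Define the estimator $$M_n=\frac{1}{n(n-1)}\sum_{i=1}^n\sum_{j\ne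 i}K(x_i,x_j)-\frac{2}{n\sqrt{1+2\gamma\sigma^2}}\sum_{i=1}^n{}_1F_1\!\left(\tfrac12;\tfrac d2;-\frac{\gamma}{1+2\gamma\sigma^2}\|x_i\|_2^2\right)+C,$$ where $C=\iint K(y,y')\,d\mathcal N(0,\sigma^2I_d)(y)\,d\mathcal N(0,\sigma^2I_d)(y')$ depends only on $d,\gamma,\sigma$. Then: 1. $M_n$ is integrable and is an unbiased estimator of $\mathrm{SIGReg}(P)$: $\mathbb E[M_n]=\mathrm{SIGReg}(P)$. 2. The empirical SIGReg is integrable and its expectation differs from that of $M_n$ by $O(1/n)$: there is an absolute constant $A$ (independent of $d,\gamma,\sigma,P,n$) such that $$\left|\mathbb E\left[M_n-\widehat{\mathrm{SIGReg}}(\widehat P_n)\right]\right|\le \frac An .$$ This holds, with the same $A$, both for the version that averages over all directions, $\widehat{\mathrm{SIGReg}}(\widehat P_n)=\mathrm{SIGReg}(\widehat P_n)=\mathbb E_{\theta\sim\mathcal U(\mathbb S^{d-1})}[\mathrm{EP}(\theta^\top_\#\widehat P_n)]$, and for the version with finitely many random slices, $\widehat{\mathrm{SIGReg}}(\widehat P_n)=\frac1m\sum_{k=1}^m\mathrm{EP}((\theta_k)^\top_\#\widehat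 P_n)$, for every $m\ge1$ and $\theta_1,\dots,\theta_m$ i.i.d. uniform on $\mathbb S^{d-1}$ and independent of $(x_1,\dots,x_n)$. -/

import Mathlib

open MeasureTheory ProbabilityTheory
open scoped ENNReal NNReal Nat RealInnerProductSpace

noncomputable section

/-- Kummer's confluent hypergeometric function `₁F₁(a; b; z) = ∑ₖ (a)ₖ / (b)ₖ * zᵏ / k!`, where
`(a)ₖ` is the rising factorial. (The series converges for all `z` when `b > 0`.) -/
def kummer (a b z : ℝ) : ℝ :=
  ∑' k : ℕ, (ascPochhammer ℝ k).eval a / (ascPochhammer ℝ k).eval b * (z ^ k / (k ! : ℝ))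

/-- The kernel `K(x, y) = ₁F₁(1/2; d/2; -γ ‖x - y‖²)` on `ℝᵈ`. -/
def kummerKernel (d : ℕ) (γ : ℝ) (x y : EuclideanSpace ℝ (Fin d)) : ℝ :=
  kummer (1 / 2) ((d : ℝ) / 2) (-γ * ‖x - y‖ ^ 2)

/-- The spectral density on `ℝ` of the one-dimensional Gaussian kernel `exp (-γ (s - t)²)`. -/
def gaussianSpectralDensity (γ ω : ℝ) : ℝ :=
  1 / Real.sqrt (4 * Real.pi * γ) * Real.exp (-(1 / (4 * γ)) * ω ^ 2)

/-- The Epps-Pulley functional of a measure on `ℝ`: the weighted squared `L²` distance between its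
characteristic function and that of `N(0, σ²)`. -/
def eppsPulley (γ σ : ℝ) (Q : Measure ℝ) : ℝ :=
  ∫ ω : ℝ, ‖charFun Q ω - charFun (gaussianReal 0 (Real.toNNReal (σ ^ 2))) ω‖ ^ 2 *
    gaussianSpectralDensity γ ω

/-- The unit sphere `𝕊ᵈ⁻¹` of `ℝᵈ`. -/
abbrev UnitSphere (d : ℕ) : Type := Metric.sphere (0 : EuclideanSpace ℝ (Fin d)) 1

/-- The uniform distribution on the unit sphere: normalized surface measure. -/
def sphereUniform (d : ℕ) : Measure (UnitSphere d) :=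
  ((volume : Measure (EuclideanSpace ℝ (Fin d))).toSphere Set.univ)⁻¹ •
    (volume : Measure (EuclideanSpace ℝ (Fin d))).toSphere

/-- The one-dimensional slice of `P` in the direction `θ`: the law of `θᵀ x` for `x ∼ P`. -/
def slice {d : ℕ} (θ : UnitSphere d) (P : Measure (EuclideanSpace ℝ (Fin d))) : Measure ℝ :=
  P.map (fun x => ⟪(θ : EuclideanSpace ℝ (Fin d)), x⟫)

/-- The SIGReg regularizer: the Epps-Pulley functional of the slices of `P`, averaged over
uniformly distributed directions. -/
def sigReg (d : ℕ) (γ σ : ℝ) (P : Measure (EuclideanSpace ℝ (Fin d))) : ℝ :=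
  ∫ θ : UnitSphere d, eppsPulley γ σ (slice θ P) ∂(sphereUniform d)

/-- The empirical measure `(1/n) ∑ᵢ δ_{xᵢ}` of a sample. -/
def empiricalMeasure {d n : ℕ} (x : Fin n → EuclideanSpace ℝ (Fin d)) :
    Measure (EuclideanSpace ℝ (Fin d)) :=
  (n : ℝ≥0∞)⁻¹ • ∑ i, Measure.dirac (x i)

/-- The empirical SIGReg of a sample with the average over all directions taken exactly. -/
def empiricalSigReg {d n : ℕ} (γ σ : ℝ) (x : Fin n → EuclideanSpace ℝ (Fin d)) : ℝ :=
  sigReg d γ σ (empiricalMeasure x)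

/-- The empirical SIGReg of a sample with the average over directions replaced by the average over
the `m` slices `θ₁, …, θₘ`. -/
def slicedEmpiricalSigReg {d n m : ℕ} (γ σ : ℝ) (θ : Fin m → UnitSphere d)
    (x : Fin n → EuclideanSpace ℝ (Fin d)) : ℝ :=
  1 / (m : ℝ) * ∑ k, eppsPulley γ σ (slice (θ k) (empiricalMeasure x))

/-- The constant `C = ∬ K(y, y') dN(y) dN(y')` with `N = N(0, σ² I_d)`. -/
def kummerConst (d : ℕ) (γ σ : ℝ) : ℝ :=
  ∫ y, ∫ y', kummerKernel d γ y y'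
    ∂(multivariateGaussian 0 (σ ^ 2 • (1 : Matrix (Fin d) (Fin d) ℝ)))
    ∂(multivariateGaussian 0 (σ ^ 2 • (1 : Matrix (Fin d) (Fin d) ℝ)))

/-- The closed-form estimator: the U-statistic of pairwise kernel values, minus the cross term,
plus the constant `C`. -/
def kummerEstimator {d n : ℕ} (γ σ : ℝ) (x : Fin n → EuclideanSpace ℝ (Fin d)) : ℝ :=
  1 / ((n : ℝ) * ((n : ℝ) - 1)) *
      ∑ i, ∑ j ∈ Finset.univ.erase i, kummerKernel d γ (x i) (x j)
    - 2 / ((n : ℝ) * Real.sqrt (1 + 2 * γ * σ ^ 2)) *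
      ∑ i, kummer (1 / 2) ((d : ℝ) / 2) (-(γ / (1 + 2 * γ * σ ^ 2)) * ‖x i‖ ^ 2)
    + kummerConst d γ σ

end

/-! The weight in the Epps-Pulley integral is the density of `N(0, 2γ)`, whose characteristic
function is `exp (-γ t²)`. Expanding the squared modulus and exchanging integrals turns `EP(Q)` into
a squared kernel discrepancy between `Q` and `N(0, σ²)` for the kernel `exp (-γ (s - t)²)`, with an
explicit cross term (`eppsPulley_eq`). Averaging over directions replaces each `exp (-a ⟨θ, z⟩²)` by
`₁F₁(1/2; d/2; -a ‖z‖²)` (`integral_sphereUniform_exp_neg_mul_inner_sq`), because the even moments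
of `⟨θ, z⟩` are the coefficients of Kummer's series. The result is the closed form `sigReg_eq`.

Unbiasedness is then the usual argument for U-statistics: for `i ≠ j` the pair `(x i, x j)` has law
`P ⊗ P`. The same closed form at the empirical measure is the V-statistic, which adds the diagonal
terms `K(x, x) = 1`. If `U` denotes the off-diagonal mean, the two statistics differ by exactly `(U
- 1) / n`, and `|U| ≤ 1` gives the pointwise bound `2 / n`. Random slices independent of the sample
do not change the expectation, by Fubini. -/

/-! ### Moments of the uniform distribution on the sphere -/

theorem ascPochhammer_eval_mul_Gamma {a : ℝ} (ha : 0 < a) (k : ℕ) :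
    (ascPochhammer ℝ k).eval a * Real.Gamma a = Real.Gamma (k + a) := by
  induction k with
  | zero => simp
  | succ k ih =>
    rw [ascPochhammer_succ_eval, mul_right_comm, ih, Nat.cast_succ,
      show (k : ℝ) + 1 + a = (k + a) + 1 by ring, Real.Gamma_add_one (by positivity)]
    ring

theorem integral_Ioi_pow_mul_exp_neg_sq (m : ℕ) :
    ∫ r in Set.Ioi (0 : ℝ), r ^ m * Real.exp (-r ^ 2) = Real.Gamma ((m + 1) / 2) / 2 := by
  have h := integral_rpow_mul_exp_neg_rpow (p := 2) (q := m) (by norm_num)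
    (by linarith [(Nat.cast_nonneg m : (0 : ℝ) ≤ m)])
  simp only [Real.rpow_natCast, Real.rpow_ofNat] at h
  rw [h]
  ring

theorem integral_even_pow_mul_exp_neg_sq (k : ℕ) :
    ∫ x : ℝ, x ^ (2 * k) * Real.exp (-x ^ 2) = Real.Gamma (k + 1 / 2) := by
  have h := integral_comp_abs (f := fun x : ℝ => x ^ (2 * k) * Real.exp (-x ^ 2))
  simp only [sq_abs, pow_mul] at h
  simp only [pow_mul]
  rw [h]
  simp only [← pow_mul]
  rw [integral_Ioi_pow_mul_exp_neg_sq]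
  push_cast
  rw [show ((2 : ℝ) * k + 1) / 2 = k + 1 / 2 by ring]
  ring

/-- Polar coordinates: the integrand is homogeneous of degree `m` times a radial factor, so it
splits into a spherical moment and a one-dimensional Gamma integral. -/
theorem integral_inner_pow_mul_exp_neg_norm_sq_eq_integral_toSphere {E : Type*}
    [NormedAddCommGroup E] [InnerProductSpace ℝ E] [FiniteDimensional ℝ E] [MeasurableSpace E]
    [BorelSpace E] [Nontrivial E] (z : E) (m : ℕ) :
    ∫ x : E, ⟪z, x⟫ ^ m * Real.exp (-‖x‖ ^ 2) =
      (∫ θ : Metric.sphere (0 : E) 1, ⟪z, (θ : E)⟫ ^ m ∂(volume : Measure E).toSphere) *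
        (Real.Gamma ((m + Module.finrank ℝ E) / 2) / 2) := by
  have hd : 0 < Module.finrank ℝ E := Module.finrank_pos
  calc ∫ x : E, ⟪z, x⟫ ^ m * Real.exp (-‖x‖ ^ 2)
      = ∫ x : ({(0)}ᶜ : Set E), ⟪z, x.1⟫ ^ m * Real.exp (-‖x.1‖ ^ 2)
          ∂((volume : Measure E).comap (↑)) := by
        rw [integral_subtype_comap (measurableSet_singleton _).compl
          fun x => ⟪z, x⟫ ^ m * Real.exp (-‖x‖ ^ 2), restrict_compl_singleton]
    _ = ∫ p : Metric.sphere (0 : E) 1 × Set.Ioi (0 : ℝ),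
          ⟪z, (p.1 : E)⟫ ^ m * ((p.2 : ℝ) ^ m * Real.exp (-(p.2 : ℝ) ^ 2))
          ∂(volume : Measure E).toSphere.prod (.volumeIoiPow (Module.finrank ℝ E - 1)) := by
        rw [← (volume : Measure E).measurePreserving_homeomorphUnitSphereProd.integral_comp
          (Homeomorph.measurableEmbedding _)]
        refine integral_congr_ae (.of_forall fun x => ?_)
        have hx : ‖(x : E)‖ ≠ 0 := norm_ne_zero_iff.2 x.2
        simp only [homeomorphUnitSphereProd_apply_fst_coe,
          homeomorphUnitSphereProd_apply_snd_coe, real_inner_smul_right]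
        rw [← mul_assoc, ← mul_pow]
        congr 2
        field_simp
    _ = _ := by
        rw [integral_prod_mul (fun θ : Metric.sphere (0 : E) 1 => ⟪z, (θ : E)⟫ ^ m)
          (fun r : Set.Ioi (0 : ℝ) => (r : ℝ) ^ m * Real.exp (-(r : ℝ) ^ 2))]
        congr 1
        simp only [Measure.volumeIoiPow, ENNReal.ofReal]
        rw [integral_withDensity_eq_integral_smul (by fun_prop),
          integral_subtype_comap measurableSet_Ioi fun a : ℝ =>
            Real.toNNReal (a ^ (Module.finrank ℝ E - 1)) • (a ^ m * Real.exp (-a ^ 2)),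
          -- The radial measure contributes `r ^ (dim - 1)`, which raises the exponent from `m` to
          -- `m + dim - 1`.
          setIntegral_congr_fun (g := fun r : ℝ =>
            r ^ (m + (Module.finrank ℝ E - 1)) * Real.exp (-r ^ 2)) measurableSet_Ioi fun x hx => ?_]
        · rw [integral_Ioi_pow_mul_exp_neg_sq]
          push_cast [Nat.cast_sub (show 1 ≤ Module.finrank ℝ E from hd)]
          congr 2
          ring
        · simp only [NNReal.smul_def, smul_eq_mul]
          rw [Real.coe_toNNReal _ (pow_nonneg (le_of_lt hx) _)]
          ring

theorem exists_orthonormalBasis_inner_eq {d : ℕ} (hd : 1 ≤ d) (z : EuclideanSpace ℝ (Fin d)) :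
    ∃ (b : OrthonormalBasis (Fin d) ℝ (EuclideanSpace ℝ (Fin d))) (i : Fin d),
      ∀ x, ⟪z, x⟫ = ‖z‖ * b.repr x i := by
  by_cases hz : z = 0
  · exact ⟨EuclideanSpace.basisFun _ _, ⟨0, hd⟩, by simp [hz]⟩
  have hz' : ‖z‖ ≠ 0 := norm_ne_zero_iff.2 hz
  obtain ⟨b, hb⟩ := Orthonormal.exists_orthonormalBasis_extension_of_card_eq (𝕜 := ℝ)
    (ι := Fin d) (E := EuclideanSpace ℝ (Fin d)) (by simp) (v := fun _ => ‖z‖⁻¹ • z)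
    (s := {⟨0, hd⟩}) (by
      refine ⟨fun i => ?_, fun i j hij => absurd (Subsingleton.elim i j) hij⟩
      simp [norm_smul, hz'])
  refine ⟨b, ⟨0, hd⟩, fun x => ?_⟩
  rw [b.repr_apply_apply, hb _ rfl, real_inner_smul_left]
  field_simp

/-- The Gaussian weight is rotation invariant, so `z` may be moved onto a coordinate axis; the
integral is then a product of `d` one-dimensional ones. -/
theorem integral_inner_even_pow_mul_exp_neg_norm_sq {d : ℕ} (hd : 1 ≤ d)
    (z : EuclideanSpace ℝ (Fin d)) (k : ℕ) :
    ∫ x : EuclideanSpace ℝ (Fin d), ⟪z, x⟫ ^ (2 * k) * Real.exp (-‖x‖ ^ 2) =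
      ‖z‖ ^ (2 * k) * Real.Gamma (k + 1 / 2) * Real.sqrt Real.pi ^ (d - 1) := by
  obtain ⟨b, i, hb⟩ := exists_orthonormalBasis_inner_eq hd z
  have h0 : ∫ x : ℝ, Real.exp (-x ^ 2) = Real.sqrt Real.pi := by
    simpa [Real.Gamma_one_half_eq, -one_div] using integral_even_pow_mul_exp_neg_sq 0
  calc _ = ∫ x : EuclideanSpace ℝ (Fin d),
        (‖z‖ * b.repr x i) ^ (2 * k) * Real.exp (-‖b.repr x‖ ^ 2) := by
        simp only [hb, LinearIsometryEquiv.norm_map]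
    _ = ∫ x : EuclideanSpace ℝ (Fin d), (‖z‖ * x i) ^ (2 * k) * Real.exp (-‖x‖ ^ 2) :=
        b.measurePreserving_repr.integral_comp
          b.repr.toHomeomorph.measurableEmbedding
          (fun x : EuclideanSpace ℝ (Fin d) => (‖z‖ * x i) ^ (2 * k) * Real.exp (-‖x‖ ^ 2))
    _ = ∫ x : Fin d → ℝ, (‖z‖ * x i) ^ (2 * k) * Real.exp (-∑ j, x j ^ 2) := by
        rw [← (PiLp.volume_preserving_ofLp (Fin d)).integral_comp
          (MeasurableEquiv.toLp 2 (Fin d → ℝ)).symm.measurableEmbedding]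
        simp [EuclideanSpace.norm_sq_eq]
    _ = ‖z‖ ^ (2 * k) * ∫ x : Fin d → ℝ,
          ∏ j, (if j = i then x j ^ (2 * k) else 1) * Real.exp (-x j ^ 2) := by
        rw [← integral_const_mul]
        refine integral_congr_ae (.of_forall fun x => ?_)
        simp only
        rw [Finset.prod_mul_distrib, ← Real.exp_sum, Finset.prod_ite_eq', Finset.sum_neg_distrib]
        simp [mul_pow, mul_assoc]
    _ = _ := by
        rw [integral_fintype_prod_volume_eq_prod
          (f := fun j (t : ℝ) => (if j = i then t ^ (2 * k) else 1) * Real.exp (-t ^ 2)),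
          ← Finset.mul_prod_erase Finset.univ _ (Finset.mem_univ i)]
        rw [Finset.prod_congr rfl (g := fun _ => Real.sqrt Real.pi) (fun j hj => by
          simp [Finset.ne_of_mem_erase hj, h0])]
        simp [integral_even_pow_mul_exp_neg_sq, mul_assoc]

theorem isProbabilityMeasure_sphereUniform {d : ℕ} (hd : 1 ≤ d) :
    IsProbabilityMeasure (sphereUniform d) := by
  have : Nontrivial (EuclideanSpace ℝ (Fin d)) :=
    Module.nontrivial_of_finrank_pos (R := ℝ) (by rw [finrank_euclideanSpace_fin]; omega)
  refine ⟨?_⟩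
  rw [sphereUniform, Measure.smul_apply, smul_eq_mul]
  exact ENNReal.inv_mul_cancel (by simp [-Measure.toSphere_apply_univ]) (measure_ne_top _ _)

/-- Polar and Cartesian evaluations of one Gaussian integral are compared, for exponent `2k` and for
exponent `0`. The case `0` gives the total surface mass, and in the quotient the Gamma values and
powers of `√π` cancel. -/
theorem integral_sphereUniform_inner_even_pow {d : ℕ} (hd : 1 ≤ d)
    (z : EuclideanSpace ℝ (Fin d)) (k : ℕ) :
    ∫ θ : UnitSphere d, ⟪(θ : EuclideanSpace ℝ (Fin d)), z⟫ ^ (2 * k) ∂sphereUniform d =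
      (ascPochhammer ℝ k).eval (1 / 2) / (ascPochhammer ℝ k).eval ((d : ℝ) / 2) *
        ‖z‖ ^ (2 * k) := by
  have : Nontrivial (EuclideanSpace ℝ (Fin d)) :=
    Module.nontrivial_of_finrank_pos (R := ℝ) (by rw [finrank_euclideanSpace_fin]; omega)
  have hd0 : (0 : ℝ) < d / 2 := by have : (1 : ℝ) ≤ d := by exact_mod_cast hd
                                   linarith
  have hk := integral_inner_pow_mul_exp_neg_norm_sq_eq_integral_toSphere z (2 * k)
  have h0 := integral_inner_pow_mul_exp_neg_norm_sq_eq_integral_toSphere z 0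
  have e0 := integral_inner_even_pow_mul_exp_neg_norm_sq hd z 0
  rw [integral_inner_even_pow_mul_exp_neg_norm_sq hd z k, finrank_euclideanSpace_fin] at hk
  rw [mul_zero] at e0
  rw [e0, finrank_euclideanSpace_fin] at h0
  simp only [pow_zero, one_mul, CharP.cast_eq_zero, zero_add, integral_const,
    smul_eq_mul, mul_one] at h0
  push_cast at hk
  rw [show (2 * (k : ℝ) + d) / 2 = k + d / 2 by ring, ← ascPochhammer_eval_mul_Gamma hd0,
    ← ascPochhammer_eval_mul_Gamma (by norm_num : (0 : ℝ) < 1 / 2)] at hk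
  rw [sphereUniform, integral_smul_measure, ENNReal.toReal_inv, smul_eq_mul]
  simp only [real_inner_comm z]
  change ((volume : Measure (EuclideanSpace ℝ (Fin d))).toSphere.real Set.univ)⁻¹ * _ = _
  generalize (volume : Measure (EuclideanSpace ℝ (Fin d))).toSphere.real Set.univ = S at *
  generalize ∫ θ : Metric.sphere (0 : EuclideanSpace ℝ (Fin d)) 1,
    ⟪z, (θ : EuclideanSpace ℝ (Fin d))⟫ ^ (2 * k)
      ∂(volume : Measure (EuclideanSpace ℝ (Fin d))).toSphere = I at *
  have hG : 0 < Real.Gamma ((d : ℝ) / 2) := Real.Gamma_pos_of_pos hd0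
  have hH : 0 < Real.Gamma (1 / 2 : ℝ) := Real.Gamma_pos_of_pos (by norm_num)
  have hp : 0 < Real.sqrt Real.pi ^ (d - 1) := by positivity
  have hA : 0 < (ascPochhammer ℝ k).eval ((d : ℝ) / 2) := ascPochhammer_pos k _ hd0
  have hS : S ≠ 0 := by
    rintro rfl
    rw [zero_mul] at h0
    exact (mul_pos hH hp).ne' h0
  generalize Real.Gamma ((d : ℝ) / 2) = G at *
  generalize Real.Gamma (1 / 2 : ℝ) = H at *
  generalize Real.sqrt Real.pi ^ (d - 1) = p at *
  field_simp
  have : G * (‖z‖ ^ (2 * k) * (ascPochhammer ℝ k).eval (1 / 2) * S) =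
      G * (I * (ascPochhammer ℝ k).eval ((d : ℝ) / 2)) := by
    linear_combination 2 * hk - 2 * ‖z‖ ^ (2 * k) * (ascPochhammer ℝ k).eval (1 / 2) * h0
  have := mul_left_cancel₀ hG.ne' this
  linarith

/-! ### Kummer's function as a spherical average -/

/-- The exponential series is integrated term by term, which `|⟨θ, z⟩| ≤ ‖z‖` justifies. -/
theorem integral_sphereUniform_exp_neg_mul_inner_sq {d : ℕ} (hd : 1 ≤ d) (a : ℝ)
    (z : EuclideanSpace ℝ (Fin d)) :
    ∫ θ : UnitSphere d, Real.exp (-a * ⟪(θ : EuclideanSpace ℝ (Fin d)), z⟫ ^ 2) ∂sphereUniform d =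
      kummer (1 / 2) ((d : ℝ) / 2) (-a * ‖z‖ ^ 2) := by
  have := isProbabilityMeasure_sphereUniform hd
  have hb : ∀ θ : UnitSphere d, |⟪(θ : EuclideanSpace ℝ (Fin d)), z⟫| ≤ ‖z‖ := fun θ => by
    simpa using abs_real_inner_le_norm (θ : EuclideanSpace ℝ (Fin d)) z
  have hF : ∀ (k : ℕ) (θ : UnitSphere d),
      ‖(-a * ⟪(θ : EuclideanSpace ℝ (Fin d)), z⟫ ^ 2) ^ k / (k ! : ℝ)‖ ≤
        (|a| * ‖z‖ ^ 2) ^ k / (k ! : ℝ) := fun k θ => by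
    rw [norm_div, norm_pow, norm_mul, norm_pow, norm_neg, Real.norm_natCast, Real.norm_eq_abs,
      Real.norm_eq_abs]
    gcongr
    exact hb θ
  have hi : ∀ k : ℕ, Integrable (fun θ : UnitSphere d =>
      (-a * ⟪(θ : EuclideanSpace ℝ (Fin d)), z⟫ ^ 2) ^ k / (k ! : ℝ)) (sphereUniform d) :=
    fun k => Integrable.of_bound (Continuous.aestronglyMeasurable (by fun_prop)) _
      (.of_forall (hF k))
  have hs : Summable fun k : ℕ => ∫ θ : UnitSphere d,
      ‖(-a * ⟪(θ : EuclideanSpace ℝ (Fin d)), z⟫ ^ 2) ^ k / (k ! : ℝ)‖ ∂sphereUniform d := by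
    refine Summable.of_nonneg_of_le (fun k => integral_nonneg fun _ => norm_nonneg _)
      (fun k => ?_) (Real.summable_pow_div_factorial (|a| * ‖z‖ ^ 2))
    simpa using integral_mono (hi k).norm (integrable_const _) (hF k)
  have h := (hasSum_integral_of_summable_integral_norm hi hs).tsum_eq
  simp_rw [Real.exp_eq_exp_ℝ, NormedSpace.exp_eq_tsum_div]
  rw [← h, kummer]
  refine tsum_congr fun k => ?_
  rw [mul_pow, pow_right_comm]
  simp only [mul_pow, ← pow_mul, integral_div, integral_const_mul,
    integral_sphereUniform_inner_even_pow hd z k]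
  ring

/-! ### The Epps-Pulley functional as a kernel discrepancy -/

/-- The product is the characteristic function of `s - t` for independent `s ∼ Q` and `t ∼ R`. By
Fubini the Gaussian integral acts on `exp (i (s - t) ω)` and yields the characteristic function of
`N(0, 2γ)` at `s - t`. -/
theorem integral_charFun_mul_conj_charFun_gaussianReal (Q R : Measure ℝ) [IsProbabilityMeasure Q]
    [IsProbabilityMeasure R] {γ : ℝ} (hγ : 0 < γ) :
    ∫ ω, charFun Q ω * (starRingEnd ℂ) (charFun R ω) ∂gaussianReal 0 (2 * γ).toNNReal =
      ((∫ p : ℝ × ℝ, Real.exp (-γ * (p.1 - p.2) ^ 2) ∂Q.prod R : ℝ) : ℂ) := by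
  have h1 : ∀ ω : ℝ, charFun Q ω * (starRingEnd ℂ) (charFun R ω) =
      ∫ p : ℝ × ℝ, Complex.exp (((p.1 - p.2 : ℝ) : ℂ) * ω * Complex.I) ∂Q.prod R := fun ω => by
    rw [charFun_apply_real, charFun_apply_real, ← integral_conj, ← integral_prod_mul]
    refine integral_congr_ae (.of_forall fun p => ?_)
    simp only [← Complex.exp_conj, ← Complex.exp_add, map_mul, Complex.conj_ofReal, Complex.conj_I]
    congr 1
    push_cast
    ring
  simp_rw [h1]
  rw [integral_integral_swap, ← integral_complex_ofReal]
  · refine integral_congr_ae (.of_forall fun p => ?_)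
    have h2 := charFun_gaussianReal (μ := 0) (v := (2 * γ).toNNReal) (p.1 - p.2)
    rw [charFun_apply_real] at h2
    simp only [h2, Complex.ofReal_exp]
    rw [Real.coe_toNNReal _ (by positivity)]
    congr 1
    push_cast
    ring
  · refine Integrable.of_bound (C := 1) (Measurable.aestronglyMeasurable ?_) (.of_forall fun q => ?_)
    · unfold Function.uncurry
      fun_prop
    · simp only [Function.uncurry]
      rw [← Complex.ofReal_mul, Complex.norm_exp_ofReal_mul_I]

theorem eppsPulley_eq_integral_gaussianReal {γ : ℝ} (hγ : 0 < γ) (σ : ℝ) (Q : Measure ℝ) :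
    eppsPulley γ σ Q = ∫ ω, ‖charFun Q ω - charFun (gaussianReal 0 (Real.toNNReal (σ ^ 2))) ω‖ ^ 2
      ∂gaussianReal 0 (2 * γ).toNNReal := by
  rw [integral_gaussianReal_eq_integral_smul (by simpa using hγ), eppsPulley]
  refine integral_congr_ae (.of_forall fun ω => ?_)
  simp only [gaussianSpectralDensity, gaussianPDFReal, smul_eq_mul]
  rw [Real.coe_toNNReal _ (by positivity), mul_comm]
  congr 2
  · rw [one_div]
    congr 2
    ring
  · congr 1
    field_simp
    ring

theorem integral_exp_neg_mul_sub_sq_gaussianReal {γ σ : ℝ} (hγ : 0 < γ) (hσ : 0 < σ) (s : ℝ) :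
    ∫ t, Real.exp (-γ * (s - t) ^ 2) ∂gaussianReal 0 (Real.toNNReal (σ ^ 2)) =
      1 / Real.sqrt (1 + 2 * γ * σ ^ 2) *
        Real.exp (-(γ / (1 + 2 * γ * σ ^ 2)) * s ^ 2) := by
  have hD : 0 < 1 + 2 * γ * σ ^ 2 := by positivity
  set D := 1 + 2 * γ * σ ^ 2 with hDdef
  -- Collecting the quadratic terms in `t` leaves a Gaussian density of variance `σ² / D` times `exp
  -- (2γst)`, so its moment generating function at `2γs` gives the integral.
  have hv : 0 < σ ^ 2 / D := by positivity
  have hm := mgf_gaussianReal (p := gaussianReal 0 (Real.toNNReal (σ ^ 2 / D))) (X := id)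
    (by rw [Measure.map_id]) (2 * γ * s)
  rw [mgf, integral_gaussianReal_eq_integral_smul (by simpa using hv),
    Real.coe_toNNReal _ hv.le] at hm
  rw [integral_gaussianReal_eq_integral_smul (by simpa using hσ.ne')]
  have : ∀ t : ℝ, gaussianPDFReal 0 (Real.toNNReal (σ ^ 2)) t • Real.exp (-γ * (s - t) ^ 2) =
      1 / Real.sqrt D * Real.exp (-γ * s ^ 2) *
        (gaussianPDFReal 0 (Real.toNNReal (σ ^ 2 / D)) t • Real.exp (2 * γ * s * id t)) := by
    intro t
    simp only [gaussianPDFReal, smul_eq_mul, id]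
    rw [Real.coe_toNNReal _ hv.le, Real.coe_toNNReal _ (by positivity), ← mul_div_assoc,
      Real.sqrt_div' _ hD.le, inv_div]
    have hsD : Real.sqrt D ≠ 0 := by positivity
    have : ∀ a b c d e : ℝ, a + b = c + d + e → Real.exp a * Real.exp b =
      Real.exp c * (Real.exp d * Real.exp e) := fun a b c d e h => by
      rw [← Real.exp_add, ← Real.exp_add, ← Real.exp_add, h, add_assoc]
    rw [mul_assoc, this (-(t - 0) ^ 2 / (2 * σ ^ 2)) _ (-γ * s ^ 2)
      (-(t - 0) ^ 2 / (2 * (σ ^ 2 / D))) (2 * γ * s * t)]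
    · field_simp
    · field_simp
      rw [hDdef]
      ring
  simp_rw [this]
  rw [integral_const_mul, hm, mul_assoc, ← Real.exp_add]
  congr 2
  field_simp
  rw [hDdef]
  ring

theorem integrable_exp_neg_mul_sq_comp {α : Type*} [MeasurableSpace α] (μ : Measure α)
    [IsFiniteMeasure μ] {a : ℝ} (ha : 0 ≤ a) {f : α → ℝ} (hf : AEMeasurable f μ) :
    Integrable (fun x => Real.exp (-a * f x ^ 2)) μ := by
  refine Integrable.of_bound (C := 1) (AEMeasurable.aestronglyMeasurable (by fun_prop))
    (.of_forall fun x => ?_)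
  rw [Real.norm_eq_abs, Real.abs_exp, Real.exp_le_one_iff]
  nlinarith [mul_nonneg ha (sq_nonneg (f x))]

theorem eppsPulley_eq {γ σ : ℝ} (hγ : 0 < γ) (hσ : 0 < σ) (Q : Measure ℝ)
    [IsProbabilityMeasure Q] :
    eppsPulley γ σ Q = ∫ p : ℝ × ℝ, Real.exp (-γ * (p.1 - p.2) ^ 2) ∂Q.prod Q
      - 2 / Real.sqrt (1 + 2 * γ * σ ^ 2) *
        ∫ s, Real.exp (-(γ / (1 + 2 * γ * σ ^ 2)) * s ^ 2) ∂Q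
      + ∫ p : ℝ × ℝ, Real.exp (-γ * (p.1 - p.2) ^ 2)
        ∂(gaussianReal 0 (Real.toNNReal (σ ^ 2))).prod
          (gaussianReal 0 (Real.toNNReal (σ ^ 2))) := by
  set N := gaussianReal 0 (Real.toNNReal (σ ^ 2)) with hN
  set G := gaussianReal 0 (2 * γ).toNNReal with hG
  have hi : ∀ (R S : Measure ℝ) [IsProbabilityMeasure R] [IsProbabilityMeasure S],
      Integrable (fun ω => charFun R ω * (starRingEnd ℂ) (charFun S ω)) G := fun R S _ _ => by
    refine Integrable.of_bound (C := 1) (Measurable.aestronglyMeasurable ?_)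
      (.of_forall fun ω => ?_)
    · exact measurable_charFun.mul (Complex.continuous_conj.measurable.comp measurable_charFun)
    · rw [norm_mul, RCLike.norm_conj]
      exact mul_le_one₀ (norm_charFun_le_one _) (norm_nonneg _) (norm_charFun_le_one _)
  have hre : ∀ (R S : Measure ℝ) [IsProbabilityMeasure R] [IsProbabilityMeasure S],
      ∫ ω, (charFun R ω * (starRingEnd ℂ) (charFun S ω)).re ∂G =
        ∫ p : ℝ × ℝ, Real.exp (-γ * (p.1 - p.2) ^ 2) ∂(R.prod S) := fun R S _ _ => by
    have := integral_re (hi R S)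
    simp only [RCLike.re_eq_complex_re] at this
    rw [this, integral_charFun_mul_conj_charFun_gaussianReal R S hγ, Complex.ofReal_re]
  -- Writing all three terms in the form `u * conj v` lets `hre` evaluate each of them.
  have hsq : ∀ u v : ℂ, ‖u - v‖ ^ 2 = (u * (starRingEnd ℂ) u).re
      - 2 * (u * (starRingEnd ℂ) v).re + (v * (starRingEnd ℂ) v).re := fun u v => by
    rw [← Complex.normSq_eq_norm_sq, Complex.normSq_apply]
    simp
    ring
  have hir : ∀ (R S : Measure ℝ) [IsProbabilityMeasure R] [IsProbabilityMeasure S],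
      Integrable (fun ω => (charFun R ω * (starRingEnd ℂ) (charFun S ω)).re) G :=
    fun R S _ _ => (hi R S).re
  have hsub : Integrable (fun ω => (charFun Q ω * (starRingEnd ℂ) (charFun Q ω)).re
      - 2 * (charFun Q ω * (starRingEnd ℂ) (charFun N ω)).re) G :=
    (hir Q Q).sub ((hir Q N).const_mul 2)
  rw [eppsPulley_eq_integral_gaussianReal hγ, ← hN, ← hG]
  simp_rw [hsq]
  rw [integral_add hsub (hir N N), integral_sub (hir Q Q) ((hir Q N).const_mul 2),
    integral_const_mul]
  rw [hre, hre, hre, integral_prod (μ := Q) (ν := N) _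
    (integrable_exp_neg_mul_sq_comp _ hγ.le (by fun_prop))]
  simp_rw [hN, integral_exp_neg_mul_sub_sq_gaussianReal hγ hσ]
  rw [integral_const_mul, ← mul_assoc, mul_one_div]

/-! ### Averaging over directions: the closed form of SIGReg -/

theorem eppsPulley_slice {d : ℕ} {γ σ : ℝ} (hγ : 0 < γ) (hσ : 0 < σ) (θ : UnitSphere d)
    (P : Measure (EuclideanSpace ℝ (Fin d))) [IsProbabilityMeasure P] :
    eppsPulley γ σ (slice θ P) =
      ∫ p : EuclideanSpace ℝ (Fin d) × EuclideanSpace ℝ (Fin d),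
        Real.exp (-γ * ⟪(θ : EuclideanSpace ℝ (Fin d)), p.1 - p.2⟫ ^ 2) ∂P.prod P
      - 2 / Real.sqrt (1 + 2 * γ * σ ^ 2) *
        ∫ x, Real.exp (-(γ / (1 + 2 * γ * σ ^ 2)) *
          ⟪(θ : EuclideanSpace ℝ (Fin d)), x⟫ ^ 2) ∂P
      + ∫ p : ℝ × ℝ, Real.exp (-γ * (p.1 - p.2) ^ 2)
        ∂(gaussianReal 0 (Real.toNNReal (σ ^ 2))).prod
          (gaussianReal 0 (Real.toNNReal (σ ^ 2))) := by
  have hm : Measurable fun x => ⟪(θ : EuclideanSpace ℝ (Fin d)), x⟫ := by fun_prop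
  have : IsProbabilityMeasure (slice θ P) := Measure.isProbabilityMeasure_map hm.aemeasurable
  rw [eppsPulley_eq hγ hσ, slice, Measure.map_prod_map _ _ hm hm,
    integral_map (hm.prodMap hm).aemeasurable
      (Measurable.aestronglyMeasurable (by fun_prop)),
    integral_map hm.aemeasurable (Measurable.aestronglyMeasurable (by fun_prop))]
  simp only [Prod.map_fst, Prod.map_snd, inner_sub_right]

theorem slice_multivariateGaussian {d : ℕ} (σ : ℝ) (θ : UnitSphere d) :
    slice θ (multivariateGaussian 0 (σ ^ 2 • (1 : Matrix (Fin d) (Fin d) ℝ))) =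
      gaussianReal 0 (Real.toNNReal (σ ^ 2)) := by
  have hm : Measurable fun x => ⟪(θ : EuclideanSpace ℝ (Fin d)), x⟫ := by fun_prop
  have : IsProbabilityMeasure
      (slice θ (multivariateGaussian 0 (σ ^ 2 • (1 : Matrix (Fin d) (Fin d) ℝ)))) :=
    Measure.isProbabilityMeasure_map hm.aemeasurable
  have hS : (σ ^ 2 • (1 : Matrix (Fin d) (Fin d) ℝ)).PosSemidef :=
    Matrix.PosSemidef.one.smul (sq_nonneg σ)
  refine Measure.ext_of_charFun (funext fun ω => ?_)
  have h := charFun_multivariateGaussian (μ := 0) hS (ω • (θ : EuclideanSpace ℝ (Fin d)))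
  have hθ : (θ : EuclideanSpace ℝ (Fin d)).ofLp ⬝ᵥ (θ : EuclideanSpace ℝ (Fin d)).ofLp = 1 := by
    have := real_inner_self_eq_norm_sq (θ : EuclideanSpace ℝ (Fin d))
    rw [norm_eq_of_mem_sphere, EuclideanSpace.inner_eq_star_dotProduct] at this
    simpa using this
  rw [slice, charFun_apply_real, integral_map hm.aemeasurable
    (Measurable.aestronglyMeasurable (by fun_prop)), charFun_gaussianReal,
    Real.coe_toNNReal _ (sq_nonneg σ)]
  rw [charFun_apply] at h
  simp only [real_inner_comm (ω • (θ : EuclideanSpace ℝ (Fin d))), real_inner_smul_left] at h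
  push_cast at h
  rw [h]
  congr 1
  simp [Matrix.smul_mulVec, hθ]
  ring_nf
  simp

/-- The spherical average replaces the alternating series by an integral of functions bounded by
`1`, so dominated convergence applies. -/
theorem continuous_kummer_norm_sq {d : ℕ} (hd : 1 ≤ d) {a : ℝ} (ha : 0 ≤ a) :
    Continuous fun z : EuclideanSpace ℝ (Fin d) =>
      kummer (1 / 2) ((d : ℝ) / 2) (-a * ‖z‖ ^ 2) := by
  have := isProbabilityMeasure_sphereUniform hd
  simp_rw [← integral_sphereUniform_exp_neg_mul_inner_sq hd]
  refine continuous_of_dominated (bound := fun _ => 1)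
    (fun z => Continuous.aestronglyMeasurable (by fun_prop)) (fun z => .of_forall fun θ => ?_)
    (integrable_const _) (.of_forall fun θ => by fun_prop)
  rw [Real.norm_eq_abs, Real.abs_exp, Real.exp_le_one_iff]
  nlinarith [mul_nonneg ha (sq_nonneg ⟪(θ : EuclideanSpace ℝ (Fin d)), z⟫)]

theorem abs_kummer_norm_sq_le_one {d : ℕ} (hd : 1 ≤ d) {a : ℝ} (ha : 0 ≤ a)
    (z : EuclideanSpace ℝ (Fin d)) :
    |kummer (1 / 2) ((d : ℝ) / 2) (-a * ‖z‖ ^ 2)| ≤ 1 := by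
  have := isProbabilityMeasure_sphereUniform hd
  rw [← integral_sphereUniform_exp_neg_mul_inner_sq hd, ← Real.norm_eq_abs]
  refine (norm_integral_le_of_norm_le_const (C := 1) (.of_forall fun θ => ?_)).trans (by simp)
  rw [Real.norm_eq_abs, Real.abs_exp, Real.exp_le_one_iff]
  nlinarith [mul_nonneg ha (sq_nonneg ⟪(θ : EuclideanSpace ℝ (Fin d)), z⟫)]

theorem integrable_kummer_norm_sq {d : ℕ} (hd : 1 ≤ d) {a : ℝ} (ha : 0 ≤ a) {α : Type*}
    [MeasurableSpace α] {μ : Measure α} [IsFiniteMeasure μ] {f : α → EuclideanSpace ℝ (Fin d)}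
    (hf : AEMeasurable f μ) :
    Integrable (fun x => kummer (1 / 2) ((d : ℝ) / 2) (-a * ‖f x‖ ^ 2)) μ :=
  Integrable.of_bound (C := 1)
    ((continuous_kummer_norm_sq hd ha).measurable.comp_aemeasurable hf).aestronglyMeasurable
    (.of_forall fun x => abs_kummer_norm_sq_le_one hd ha (f x))

theorem integrable_integral_exp_neg_mul_inner_sq {d : ℕ} (hd : 1 ≤ d) {a : ℝ} (ha : 0 ≤ a)
    {α : Type*} [MeasurableSpace α] (ν : Measure α) [IsProbabilityMeasure ν]
    {f : α → EuclideanSpace ℝ (Fin d)} (hf : Measurable f) :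
    Integrable (fun θ : UnitSphere d =>
      ∫ x, Real.exp (-a * ⟪(θ : EuclideanSpace ℝ (Fin d)), f x⟫ ^ 2) ∂ν) (sphereUniform d) ∧
    ∫ θ : UnitSphere d, ∫ x, Real.exp (-a * ⟪(θ : EuclideanSpace ℝ (Fin d)), f x⟫ ^ 2) ∂ν
      ∂sphereUniform d = ∫ x, kummer (1 / 2) ((d : ℝ) / 2) (-a * ‖f x‖ ^ 2) ∂ν := by
  have := isProbabilityMeasure_sphereUniform hd
  have hi : Integrable (fun p : UnitSphere d × α =>
      Real.exp (-a * ⟪(p.1 : EuclideanSpace ℝ (Fin d)), f p.2⟫ ^ 2))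
      ((sphereUniform d).prod ν) :=
    integrable_exp_neg_mul_sq_comp _ ha (by fun_prop)
  refine ⟨hi.integral_prod_left, ?_⟩
  rw [integral_integral_swap hi]
  simp_rw [integral_sphereUniform_exp_neg_mul_inner_sq hd]

/-- Every slice of `N(0, σ² I)` is `N(0, σ²)`, so the average over directions defining `C` is the
average of a constant. -/
theorem kummerConst_eq {d : ℕ} (hd : 1 ≤ d) {γ : ℝ} (hγ : 0 < γ) (σ : ℝ) :
    kummerConst d γ σ = ∫ p : ℝ × ℝ, Real.exp (-γ * (p.1 - p.2) ^ 2)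
        ∂(gaussianReal 0 (Real.toNNReal (σ ^ 2))).prod
          (gaussianReal 0 (Real.toNNReal (σ ^ 2))) := by
  have := isProbabilityMeasure_sphereUniform hd
  set M := multivariateGaussian 0 (σ ^ 2 • (1 : Matrix (Fin d) (Fin d) ℝ)) with hM
  have h := (integrable_integral_exp_neg_mul_inner_sq hd hγ.le (M.prod M)
    (f := fun p => p.1 - p.2) (by fun_prop)).2
  have hθ : ∀ θ : UnitSphere d, ∫ p : EuclideanSpace ℝ (Fin d) × EuclideanSpace ℝ (Fin d),
      Real.exp (-γ * ⟪(θ : EuclideanSpace ℝ (Fin d)), p.1 - p.2⟫ ^ 2) ∂M.prod M =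
      ∫ p : ℝ × ℝ, Real.exp (-γ * (p.1 - p.2) ^ 2)
        ∂(gaussianReal 0 (Real.toNNReal (σ ^ 2))).prod
          (gaussianReal 0 (Real.toNNReal (σ ^ 2))) := fun θ => by
    have hm : Measurable fun x => ⟪(θ : EuclideanSpace ℝ (Fin d)), x⟫ := by fun_prop
    rw [← slice_multivariateGaussian σ θ, ← hM, slice, Measure.map_prod_map _ _ hm hm,
      integral_map (hm.prodMap hm).aemeasurable
        (Measurable.aestronglyMeasurable (by fun_prop))]
    simp only [Prod.map_fst, Prod.map_snd, inner_sub_right]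
  simp_rw [hθ] at h
  rw [integral_const, probReal_univ, one_smul] at h
  rw [h, integral_prod _ (integrable_kummer_norm_sq hd hγ.le (by fun_prop))]
  rfl

/-- Used twice: at the law `P` for unbiasedness, and at the empirical measure for the bias. -/
theorem sigReg_eq {d : ℕ} (hd : 1 ≤ d) {γ σ : ℝ} (hγ : 0 < γ) (hσ : 0 < σ)
    (P : Measure (EuclideanSpace ℝ (Fin d))) [IsProbabilityMeasure P] :
    sigReg d γ σ P = ∫ p : EuclideanSpace ℝ (Fin d) × EuclideanSpace ℝ (Fin d),
        kummerKernel d γ p.1 p.2 ∂P.prod P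
      - 2 / Real.sqrt (1 + 2 * γ * σ ^ 2) *
        ∫ x, kummer (1 / 2) ((d : ℝ) / 2) (-(γ / (1 + 2 * γ * σ ^ 2)) * ‖x‖ ^ 2) ∂P
      + kummerConst d γ σ := by
  have := isProbabilityMeasure_sphereUniform hd
  have hγ' : 0 ≤ γ / (1 + 2 * γ * σ ^ 2) := by positivity
  obtain ⟨i1, e1⟩ := integrable_integral_exp_neg_mul_inner_sq hd hγ.le (P.prod P)
    (f := fun p => p.1 - p.2) (by fun_prop)
  obtain ⟨i2, e2⟩ := integrable_integral_exp_neg_mul_inner_sq hd hγ' P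
    (f := fun x => x) (by fun_prop)
  have hsub : Integrable (fun θ : UnitSphere d =>
      ∫ p : EuclideanSpace ℝ (Fin d) × EuclideanSpace ℝ (Fin d),
        Real.exp (-γ * ⟪(θ : EuclideanSpace ℝ (Fin d)), p.1 - p.2⟫ ^ 2) ∂P.prod P
      - 2 / Real.sqrt (1 + 2 * γ * σ ^ 2) *
        ∫ x, Real.exp (-(γ / (1 + 2 * γ * σ ^ 2)) *
          ⟪(θ : EuclideanSpace ℝ (Fin d)), x⟫ ^ 2) ∂P) (sphereUniform d) :=
    i1.sub (i2.const_mul _)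
  simp_rw [sigReg, eppsPulley_slice hγ hσ]
  rw [integral_add hsub (integrable_const _),
    integral_sub i1 (i2.const_mul _), integral_const_mul, e1, e2, kummerConst_eq hd hγ]
  simp [kummerKernel]

/-! ### Empirical measures and the pointwise bias bound -/

theorem isProbabilityMeasure_empiricalMeasure {d n : ℕ} (hn : n ≠ 0)
    (x : Fin n → EuclideanSpace ℝ (Fin d)) : IsProbabilityMeasure (empiricalMeasure x) := by
  refine ⟨?_⟩
  simp only [empiricalMeasure, Measure.smul_apply, Measure.finsetSum_apply, measure_univ,
    Finset.sum_const, Finset.card_univ, Fintype.card_fin, nsmul_eq_mul, mul_one, smul_eq_mul]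
  exact ENNReal.inv_mul_cancel (by exact_mod_cast hn) (ENNReal.natCast_ne_top n)

theorem integral_empiricalMeasure {d n : ℕ} (x : Fin n → EuclideanSpace ℝ (Fin d))
    (f : EuclideanSpace ℝ (Fin d) → ℝ) :
    ∫ y, f y ∂empiricalMeasure x = 1 / (n : ℝ) * ∑ i, f (x i) := by
  rw [empiricalMeasure, integral_smul_measure, integral_finsetSum_measure]
  · simp
  · exact fun i _ => integrable_dirac (by simp)

theorem empiricalSigReg_eq {d n : ℕ} (hd : 1 ≤ d) (hn : n ≠ 0) {γ σ : ℝ} (hγ : 0 < γ)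
    (hσ : 0 < σ) (x : Fin n → EuclideanSpace ℝ (Fin d)) :
    empiricalSigReg γ σ x = 1 / (n : ℝ) ^ 2 * ∑ i, ∑ j, kummerKernel d γ (x i) (x j)
      - 2 / ((n : ℝ) * Real.sqrt (1 + 2 * γ * σ ^ 2)) *
        ∑ i, kummer (1 / 2) ((d : ℝ) / 2) (-(γ / (1 + 2 * γ * σ ^ 2)) * ‖x i‖ ^ 2)
      + kummerConst d γ σ := by
  have := isProbabilityMeasure_empiricalMeasure hn x
  rw [empiricalSigReg, sigReg_eq hd hγ hσ, integral_empiricalMeasure, integral_prod]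
  · simp_rw [integral_empiricalMeasure]
    rw [← Finset.mul_sum]
    congr 2
    · ring
    · field_simp
  · exact integrable_kummer_norm_sq hd hγ.le (by fun_prop)

theorem eppsPulley_slice_empiricalMeasure {d n : ℕ} (hn : n ≠ 0) {γ σ : ℝ} (hγ : 0 < γ)
    (hσ : 0 < σ) (θ : UnitSphere d) (x : Fin n → EuclideanSpace ℝ (Fin d)) :
    eppsPulley γ σ (slice θ (empiricalMeasure x)) =
      1 / (n : ℝ) ^ 2 * ∑ i, ∑ j,
        Real.exp (-γ * ⟪(θ : EuclideanSpace ℝ (Fin d)), x i - x j⟫ ^ 2)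
      - 2 / ((n : ℝ) * Real.sqrt (1 + 2 * γ * σ ^ 2)) *
        ∑ i, Real.exp (-(γ / (1 + 2 * γ * σ ^ 2)) *
          ⟪(θ : EuclideanSpace ℝ (Fin d)), x i⟫ ^ 2)
      + ∫ p : ℝ × ℝ, Real.exp (-γ * (p.1 - p.2) ^ 2)
        ∂(gaussianReal 0 (Real.toNNReal (σ ^ 2))).prod
          (gaussianReal 0 (Real.toNNReal (σ ^ 2))) := by
  have := isProbabilityMeasure_empiricalMeasure hn x
  rw [eppsPulley_slice hγ hσ, integral_empiricalMeasure, integral_prod]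
  · simp_rw [integral_empiricalMeasure]
    rw [← Finset.mul_sum]
    congr 2
    · ring
    · field_simp
  · exact integrable_exp_neg_mul_sq_comp _ hγ.le (by fun_prop)

/-- Joint integrability in direction and sample is what Fubini needs for random slices; the
finite-sum formula makes it immediate. -/
theorem integrable_eppsPulley_slice_empiricalMeasure {d n : ℕ} (hn : n ≠ 0) {γ σ : ℝ}
    (hγ : 0 < γ) (hσ : 0 < σ) (ν : Measure (UnitSphere d × (Fin n → EuclideanSpace ℝ (Fin d))))
    [IsFiniteMeasure ν] :
    Integrable (fun p => eppsPulley γ σ (slice p.1 (empiricalMeasure p.2))) ν := by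
  have hγ' : 0 ≤ γ / (1 + 2 * γ * σ ^ 2) := by positivity
  simp_rw [eppsPulley_slice_empiricalMeasure hn hγ hσ]
  refine ((Integrable.const_mul (integrable_finsetSum _ fun i _ => integrable_finsetSum _
    fun j _ => integrable_exp_neg_mul_sq_comp _ hγ.le ?_) _).sub
    (Integrable.const_mul (integrable_finsetSum _ fun i _ =>
      integrable_exp_neg_mul_sq_comp _ hγ' ?_) _)).add (integrable_const _) <;> fun_prop

theorem abs_kummerEstimator_sub_empiricalSigReg_le {d n : ℕ} (hd : 1 ≤ d) (hn : 2 ≤ n)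
    {γ σ : ℝ} (hγ : 0 < γ) (hσ : 0 < σ) (x : Fin n → EuclideanSpace ℝ (Fin d)) :
    |kummerEstimator γ σ x - empiricalSigReg γ σ x| ≤ 2 / n := by
  have hn' : (2 : ℝ) ≤ n := by exact_mod_cast hn
  have hn1 : (0 : ℝ) < (n : ℝ) - 1 := by linarith
  have hK0 : kummer (1 / 2) ((d : ℝ) / 2) (-γ * ‖(0 : EuclideanSpace ℝ (Fin d))‖ ^ 2) = 1 := by
    have := isProbabilityMeasure_sphereUniform hd
    rw [← integral_sphereUniform_exp_neg_mul_inner_sq hd]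
    simp
  have hsum : ∀ i, ∑ j, kummerKernel d γ (x i) (x j) =
      1 + ∑ j ∈ Finset.univ.erase i, kummerKernel d γ (x i) (x j) := fun i => by
    rw [← Finset.add_sum_erase _ _ (Finset.mem_univ i), kummerKernel, sub_self, hK0]
  have hS : |∑ i, ∑ j ∈ Finset.univ.erase i, kummerKernel d γ (x i) (x j)| ≤
      (n : ℝ) * (n - 1) := by
    calc _ ≤ ∑ i : Fin n, ∑ j ∈ Finset.univ.erase i, (1 : ℝ) :=
          (Finset.abs_sum_le_sum_abs _ _).trans (Finset.sum_le_sum fun i _ =>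
            (Finset.abs_sum_le_sum_abs _ _).trans (Finset.sum_le_sum fun j _ =>
              abs_kummer_norm_sq_le_one hd hγ.le _))
      _ = _ := by
          simp [Finset.card_erase_of_mem, Nat.cast_sub (show 1 ≤ n by omega)]
          ring
  rw [empiricalSigReg_eq hd (by omega) hγ hσ, kummerEstimator]
  simp_rw [hsum]
  rw [Finset.sum_add_distrib]
  generalize ∑ i, ∑ j ∈ Finset.univ.erase i, kummerKernel d γ (x i) (x j) = S at *
  simp only [Finset.sum_const, Finset.card_univ, Fintype.card_fin, nsmul_eq_mul, mul_one]
  have hn0 : (0 : ℝ) < n := by linarith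
  -- The cross terms and `C` cancel, leaving `(U - 1) / n` with `U = S / (n (n - 1))`.
  rw [show ∀ a b c e : ℝ, a - b + c - (e - b + c) = a - e by intros; ring,
    show 1 / ((n : ℝ) * (n - 1)) * S - 1 / (n : ℝ) ^ 2 * (n + S) =
      (S / ((n : ℝ) * (n - 1)) - 1) / n by field_simp; ring, abs_div, abs_of_pos hn0]
  gcongr
  refine (abs_sub _ _).trans ?_
  rw [abs_div, abs_of_pos (mul_pos hn0 hn1), abs_one]
  have := (div_le_one (mul_pos hn0 hn1)).2 hS
  linarith

/-! ### Expectations over the random sample and random directions -/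

section Sample

variable {d n : ℕ} {γ σ : ℝ} {Ω : Type*} [MeasurableSpace Ω] {μ : Measure Ω}
  [IsProbabilityMeasure μ] {x : Fin n → Ω → EuclideanSpace ℝ (Fin d)}

theorem integrable_kummerEstimator (hd : 1 ≤ d) (hγ : 0 < γ) (σ : ℝ)
    (hx : ∀ i, AEMeasurable (x i) μ) :
    Integrable (fun ω => kummerEstimator γ σ (fun i => x i ω)) μ := by
  have hγ' : 0 ≤ γ / (1 + 2 * γ * σ ^ 2) := by positivity
  exact ((Integrable.const_mul (integrable_finsetSum _ fun i _ => integrable_finsetSum _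
    fun j _ => integrable_kummer_norm_sq hd hγ.le ((hx i).sub (hx j))) _).sub
    (Integrable.const_mul (integrable_finsetSum _ fun i _ =>
      integrable_kummer_norm_sq hd hγ' (hx i)) _)).add (integrable_const _)

theorem integrable_empiricalSigReg (hd : 1 ≤ d) (hn : n ≠ 0) (hγ : 0 < γ) (hσ : 0 < σ)
    (hx : ∀ i, AEMeasurable (x i) μ) :
    Integrable (fun ω => empiricalSigReg γ σ (fun i => x i ω)) μ := by
  have hγ' : 0 ≤ γ / (1 + 2 * γ * σ ^ 2) := by positivity
  simp_rw [empiricalSigReg_eq hd hn hγ hσ]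
  exact ((Integrable.const_mul (integrable_finsetSum _ fun i _ => integrable_finsetSum _
    fun j _ => integrable_kummer_norm_sq hd hγ.le ((hx i).sub (hx j))) _).sub
    (Integrable.const_mul (integrable_finsetSum _ fun i _ =>
      integrable_kummer_norm_sq hd hγ' (hx i)) _)).add (integrable_const _)

theorem integral_kummerEstimator (hd : 1 ≤ d) (hn : 2 ≤ n) (hγ : 0 < γ) (hσ : 0 < σ)
    (P : Measure (EuclideanSpace ℝ (Fin d))) [IsProbabilityMeasure P]
    (hx : ∀ i, HasLaw (x i) P μ) (hind : iIndepFun x μ) :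
    ∫ ω, kummerEstimator γ σ (fun i => x i ω) ∂μ = sigReg d γ σ P := by
  have hγ' : 0 ≤ γ / (1 + 2 * γ * σ ^ 2) := by positivity
  have hn' : (2 : ℝ) ≤ n := by exact_mod_cast hn
  have hn0 : (n : ℝ) ≠ 0 := by linarith
  have hn1 : (n : ℝ) - 1 ≠ 0 := by linarith
  have i1 : ∀ i j, Integrable (fun ω => kummerKernel d γ (x i ω) (x j ω)) μ := fun i j =>
    integrable_kummer_norm_sq hd hγ.le ((hx i).aemeasurable.sub (hx j).aemeasurable)
  have i2 : ∀ i, Integrable (fun ω => kummer (1 / 2) ((d : ℝ) / 2)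
      (-(γ / (1 + 2 * γ * σ ^ 2)) * ‖x i ω‖ ^ 2)) μ := fun i =>
    integrable_kummer_norm_sq hd hγ' (hx i).aemeasurable
  have e1 : ∀ i, ∀ j ∈ Finset.univ.erase i, ∫ ω, kummerKernel d γ (x i ω) (x j ω) ∂μ =
      ∫ p : EuclideanSpace ℝ (Fin d) × EuclideanSpace ℝ (Fin d),
        kummerKernel d γ p.1 p.2 ∂P.prod P := fun i j hj => by
    -- Off the diagonal, independence makes the joint law of the pair `P ⊗ P`.
    have h := (indepFun_iff_map_prod_eq_prod_map_map (hx i).aemeasurable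
      (hx j).aemeasurable).1 (hind.indepFun (Finset.ne_of_mem_erase hj).symm)
    rw [(hx i).map_eq, (hx j).map_eq] at h
    rw [← h, integral_map ((hx i).aemeasurable.prodMk (hx j).aemeasurable)]
    exact ((continuous_kummer_norm_sq hd hγ.le).comp
      (continuous_fst.sub continuous_snd)).aestronglyMeasurable
  have e2 : ∀ i, ∫ ω, kummer (1 / 2) ((d : ℝ) / 2)
      (-(γ / (1 + 2 * γ * σ ^ 2)) * ‖x i ω‖ ^ 2) ∂μ =
      ∫ y, kummer (1 / 2) ((d : ℝ) / 2) (-(γ / (1 + 2 * γ * σ ^ 2)) * ‖y‖ ^ 2) ∂P := fun i =>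
    (hx i).integral_comp (continuous_kummer_norm_sq hd hγ').aestronglyMeasurable
  have I1 : Integrable (fun ω => 1 / ((n : ℝ) * ((n : ℝ) - 1)) *
      ∑ i, ∑ j ∈ Finset.univ.erase i, kummerKernel d γ (x i ω) (x j ω)) μ :=
    (integrable_finsetSum _ fun i _ => integrable_finsetSum _ fun j _ => i1 i j).const_mul _
  have I2 : Integrable (fun ω => 2 / ((n : ℝ) * Real.sqrt (1 + 2 * γ * σ ^ 2)) *
      ∑ i, kummer (1 / 2) ((d : ℝ) / 2) (-(γ / (1 + 2 * γ * σ ^ 2)) * ‖x i ω‖ ^ 2)) μ :=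
    (integrable_finsetSum _ fun i _ => i2 i).const_mul _
  have I12 : Integrable (fun ω => 1 / ((n : ℝ) * ((n : ℝ) - 1)) *
      ∑ i, ∑ j ∈ Finset.univ.erase i, kummerKernel d γ (x i ω) (x j ω)
      - 2 / ((n : ℝ) * Real.sqrt (1 + 2 * γ * σ ^ 2)) *
      ∑ i, kummer (1 / 2) ((d : ℝ) / 2) (-(γ / (1 + 2 * γ * σ ^ 2)) * ‖x i ω‖ ^ 2)) μ :=
    I1.sub I2
  simp only [kummerEstimator]
  rw [integral_add I12 (integrable_const _), integral_sub I1 I2, integral_const_mul,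
    integral_const_mul, integral_finsetSum _ fun i _ => i2 i,
    integral_finsetSum _ fun i _ => integrable_finsetSum _ fun j _ => i1 i j,
    Finset.sum_congr rfl fun i _ => (integral_finsetSum _ fun j _ => i1 i j).trans
      (Finset.sum_congr rfl (e1 i)), Finset.sum_congr rfl fun i _ => e2 i, sigReg_eq hd hγ hσ]
  simp only [Finset.sum_const, Finset.card_erase_of_mem (Finset.mem_univ _), Finset.card_univ,
    Fintype.card_fin, nsmul_eq_mul, Nat.cast_sub (show 1 ≤ n by omega), Nat.cast_one,
    integral_const, probReal_univ, one_smul]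
  congr 2
  · field_simp
  · field_simp

theorem integrable_eppsPulley_slice_sample (hn : n ≠ 0) (hγ : 0 < γ) (hσ : 0 < σ)
    (hx : ∀ i, AEMeasurable (x i) μ) {θ : Ω → UnitSphere d} (hθ : AEMeasurable θ μ) :
    Integrable (fun ω => eppsPulley γ σ (slice (θ ω) (empiricalMeasure fun i => x i ω))) μ :=
  (integrable_eppsPulley_slice_empiricalMeasure hn hγ hσ
    (μ.map fun ω => (θ ω, fun i => x i ω))).comp_aemeasurable
      (hθ.prodMk (aemeasurable_pi_lambda _ hx))

/-- The joint law of direction and sample is a product, so the direction can be integrated first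
with the sample fixed; that inner integral is the exact average over the sphere. -/
theorem integral_eppsPulley_slice_sample (hd : 1 ≤ d) (hn : n ≠ 0)
    (hγ : 0 < γ) (hσ : 0 < σ) (hx : ∀ i, AEMeasurable (x i) μ) {θ : Ω → UnitSphere d}
    (hθ : HasLaw θ (sphereUniform d) μ) (hind : IndepFun θ (fun ω i => x i ω) μ) :
    ∫ ω, eppsPulley γ σ (slice (θ ω) (empiricalMeasure fun i => x i ω)) ∂μ =
      ∫ ω, empiricalSigReg γ σ (fun i => x i ω) ∂μ := by
  have := isProbabilityMeasure_sphereUniform hd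
  have hX : AEMeasurable (fun ω i => x i ω) μ := aemeasurable_pi_lambda _ hx
  have : IsProbabilityMeasure (μ.map fun ω i => x i ω) := Measure.isProbabilityMeasure_map hX
  have hlaw := (indepFun_iff_map_prod_eq_prod_map_map hθ.aemeasurable hX).1 hind
  rw [hθ.map_eq] at hlaw
  have hF := integrable_eppsPulley_slice_empiricalMeasure (d := d) hn hγ hσ
    ((sphereUniform d).prod (μ.map fun ω i => x i ω))
  have hFm := hF.aestronglyMeasurable
  rw [← hlaw] at hFm
  calc _ = ∫ p, eppsPulley γ σ (slice p.1 (empiricalMeasure p.2))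
        ∂(sphereUniform d).prod (μ.map fun ω i => x i ω) := by
        rw [← hlaw, integral_map (hθ.aemeasurable.prodMk hX) hFm]
    _ = ∫ y, empiricalSigReg γ σ y ∂(μ.map fun ω i => x i ω) := integral_prod_symm _ hF
    _ = _ := integral_map hX hF.integral_prod_right.aestronglyMeasurable

theorem integrable_slicedEmpiricalSigReg {m : ℕ} (hn : n ≠ 0) (hγ : 0 < γ) (hσ : 0 < σ)
    (hx : ∀ i, AEMeasurable (x i) μ) {θ : Fin m → Ω → UnitSphere d}
    (hθ : ∀ k, AEMeasurable (θ k) μ) :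
    Integrable (fun ω => slicedEmpiricalSigReg γ σ (fun k => θ k ω) (fun i => x i ω)) μ :=
  (integrable_finsetSum _ fun k _ =>
    integrable_eppsPulley_slice_sample hn hγ hσ hx (hθ k)).const_mul _

theorem integral_slicedEmpiricalSigReg {m : ℕ} (hd : 1 ≤ d) (hn : n ≠ 0) (hm : m ≠ 0)
    (hγ : 0 < γ) (hσ : 0 < σ) (hx : ∀ i, AEMeasurable (x i) μ) {θ : Fin m → Ω → UnitSphere d}
    (hθ : ∀ k, HasLaw (θ k) (sphereUniform d) μ)
    (hind : IndepFun (fun ω i => x i ω) (fun ω k => θ k ω) μ) :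
    ∫ ω, slicedEmpiricalSigReg γ σ (fun k => θ k ω) (fun i => x i ω) ∂μ =
      ∫ ω, empiricalSigReg γ σ (fun i => x i ω) ∂μ := by
  have hk : ∀ k, ∫ ω, eppsPulley γ σ (slice (θ k ω) (empiricalMeasure fun i => x i ω)) ∂μ =
      ∫ ω, empiricalSigReg γ σ (fun i => x i ω) ∂μ := fun k =>
    integral_eppsPulley_slice_sample hd hn hγ hσ hx (hθ k)
      (hind.symm.comp (measurable_pi_apply k) measurable_id)
  simp only [slicedEmpiricalSigReg]
  rw [integral_const_mul, integral_finsetSum _ fun k _ =>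
    integrable_eppsPulley_slice_sample hn hγ hσ hx (hθ k).aemeasurable]
  simp_rw [hk]
  simp [hm]

end Sample

theorem mainTheorem2 :
    ∃ A : ℝ, ∀ (d : ℕ), 1 ≤ d → ∀ (γ σ : ℝ), 0 < γ → 0 < σ →
      ∀ (P : Measure (EuclideanSpace ℝ (Fin d))), IsProbabilityMeasure P →
      ∀ (n : ℕ), 2 ≤ n →
      ∀ (Ω : Type*) [MeasurableSpace Ω] (μ : Measure Ω) [IsProbabilityMeasure μ]
        (x : Fin n → Ω → EuclideanSpace ℝ (Fin d)),
        (∀ i, HasLaw (x i) P μ) → iIndepFun x μ →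
        (Integrable (fun ω => kummerEstimator γ σ (fun i => x i ω)) μ ∧
          ∫ ω, kummerEstimator γ σ (fun i => x i ω) ∂μ = sigReg d γ σ P) ∧
        (Integrable (fun ω => empiricalSigReg γ σ (fun i => x i ω)) μ ∧
          |∫ ω, (kummerEstimator γ σ (fun i => x i ω) - empiricalSigReg γ σ (fun i => x i ω)) ∂μ|
            ≤ A / n) ∧
        (∀ (m : ℕ), 1 ≤ m → ∀ (θ : Fin m → Ω → UnitSphere d),
          (∀ k, HasLaw (θ k) (sphereUniform d) μ) → iIndepFun θ μ →
          IndepFun (fun ω i => x i ω) (fun ω k => θ k ω) μ →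
          Integrable (fun ω =>
            slicedEmpiricalSigReg γ σ (fun k => θ k ω) (fun i => x i ω)) μ ∧
          |∫ ω, (kummerEstimator γ σ (fun i => x i ω) -
              slicedEmpiricalSigReg γ σ (fun k => θ k ω) (fun i => x i ω)) ∂μ| ≤ A / n) := by
  -- The constant is `|U| + 1 ≤ 2`, from the pointwise bound.
  refine ⟨2, fun d hd γ σ hγ hσ P _ n hn Ω _ μ _ x hx hind => ?_⟩
  have hn0 : n ≠ 0 := by omega
  have hxm : ∀ i, AEMeasurable (x i) μ := fun i => (hx i).aemeasurable
  have hM := integrable_kummerEstimator hd hγ σ hxm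
  have hE := integrable_empiricalSigReg hd hn0 hγ hσ hxm
  have hle : |∫ ω, (kummerEstimator γ σ (fun i => x i ω) - empiricalSigReg γ σ (fun i => x i ω)) ∂μ|
      ≤ 2 / n := by
    rw [← Real.norm_eq_abs]
    exact (norm_integral_le_of_norm_le_const (.of_forall fun ω =>
      abs_kummerEstimator_sub_empiricalSigReg_le hd hn hγ hσ _)).trans (by simp)
  refine ⟨⟨hM, integral_kummerEstimator hd hn hγ hσ P hx hind⟩, ⟨hE, hle⟩,
    fun m hm θ hθ _ hθx => ?_⟩
  have hS := integrable_slicedEmpiricalSigReg hn0 hγ hσ hxm fun k => (hθ k).aemeasurable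
  refine ⟨hS, ?_⟩
  -- The sliced and exact versions have equal expectation, so the bound `hle` carries over
  -- unchanged.
  rwa [integral_sub hM hS, integral_slicedEmpiricalSigReg hd hn0 (by omega) hγ hσ hxm hθ hθx,
    ← integral_sub hM hE]
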